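/- Let $0<q<1$, and write $(x;q)_n=\prod_{k=0}^{n-1}(1-xq^k)$ for integers $n\ge 0$, $(x;q)_\infty=\prod_{k=0}^{\infty}(1-xq^k)$, $(x_1,\dots,x_m;q)_n=(x_1;q)_n\cdots(x_m;q)_n$ (also for $n=\infty$), and $$ {}_{m+1}\phi_m\left({x_1,\dots,x_{m+1}\atop y_1,\dots,y_m};q,w\right)=\sum_{k=0}^\infty\frac{(x_1,\dots,x_{m+1};q)_k\,w^k}{(q,y_1,\dots,y_m;q)_k}.$$ Let $a,b,c,d,r,s,t,h,z,\beta,\delta$ be complex numbers with $\max\{|a|,|b|,|c|,|d|,|r|,|s|,|t|,|h|,|z|\}<1$, and put $\alpha=a^2bcdr/q$, where $\alpha\neq 1$. Then $$\sum_{n=0}^\infty \frac{(\beta,\delta,ab,ac,ad,ar;q)_n\,(bcdrz)^n}{(q,s,t,h,abcd,abcr;q)_n}\;{}_3\phi_2\left({abq^n,\,acq^n,\,bc\atop abcdq^n,\,abcrq^n};q,dr\right)$$ $$=\frac{(abdr,acdr;q)_\infty}{(dr,q\alpha;q)_\infty}\sum_{n=0}^\infty\frac{(1-\alpha q^{2n})(\alpha,ab,ac,ad,ar;q)_n}{(1-\alpha)(q,abcd,abcr,abdr,acdr;q)_n}(-bcdr)^n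 q^{n(n-1)/2}\;{}_4\phi_3\left({q^{-n},\,\alpha q^n,\,\beta,\,\delta\atop s,\,t,\,h};q,qz\right),$$ where all the series converge absolutely. The same also holds when $|z|=1$ (the other hypotheses being unchanged), provided that the series over $n$ on the right-hand side converges absolutely. -/

import Mathlib

/-- The finite `q`-shifted factorial `(a; q)_n = ∏_{k=0}^{n-1} (1 - a q^k)`. -/
def qPoch (a q : ℂ) (n : ℕ) : ℂ := ∏ k ∈ Finset.range n, (1 - a * q ^ k)

/-- The infinite `q`-shifted factorial `(a; q)_∞ = ∏_{k=0}^∞ (1 - a q^k)`. -/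
noncomputable def qPochInf (a q : ℂ) : ℂ := ∏' k : ℕ, (1 - a * q ^ k)

/-- For `|q| < 1` the product defining `(a; q)_∞` converges, so that it has no junk value. -/
theorem multipliable_qPochInf (a : ℂ) {q : ℂ} (hq : ‖q‖ < 1) :
    Multipliable fun k : ℕ => 1 - a * q ^ k := by
  have h : Summable fun k : ℕ => ‖-(a * q ^ k)‖ := by
    simpa [norm_mul, norm_pow] using
      (summable_geometric_of_lt_one (norm_nonneg q) hq).mul_left ‖a‖
  simpa [sub_eq_add_neg] using multipliable_one_add_of_summable h

/-- The multiple factorial `(a₁, …, a_m; q)_n = (a₁; q)_n ⋯ (a_m; q)_n`. -/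
def qPochs (as : List ℂ) (q : ℂ) (n : ℕ) : ℂ := (as.map fun a => qPoch a q n).prod

/-- The multiple factorial `(a₁, …, a_m; q)_∞ = (a₁; q)_∞ ⋯ (a_m; q)_∞`. -/
noncomputable def qPochsInf (as : List ℂ) (q : ℂ) : ℂ := (as.map fun a => qPochInf a q).prod

/-- The `n`-th term
`(a₁, …, a_{r+1}; q)_n z^n / (q, b₁, …, b_r; q)_n` of a basic hypergeometric series. -/
noncomputable def qHypTerm (as bs : List ℂ) (q z : ℂ) (n : ℕ) : ℂ :=
  qPochs as q n * z ^ n / qPochs (q :: bs) q n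

/-- The basic hypergeometric series `_{r+1}φ_r (a₁, …, a_{r+1}; b₁, …, b_r; q, z)`. -/
noncomputable def qHyp (as bs : List ℂ) (q z : ℂ) : ℂ := ∑' n : ℕ, qHypTerm as bs q z n

/-!
Expanding the terminating `₄φ₃` on the right turns the right-hand side into a double series over
`(k, m)`, where `k` is the index of the `₄φ₃` and `k + m` the outer index (`expandedTerm`). Its
terms are `O(|bcdrz| ^ k |bcdr| ^ m)`, so it converges absolutely for all `|z| ≤ 1`, and it may be
summed by rows instead of antidiagonals.

The `k`-th row is, up to a factor independent of `m`, a very-well-poised series in the parameters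
`a q ^ k, b, c, d, r`. The non-terminating limit of Watson's transformation (`watson_limit`)
evaluates it as the `₃φ₂` of the `k`-th term on the left.

The limit of Watson's transformation follows from Bailey's lemma. The Bailey pair is a terminating
very-well-poised sum (`sum_baileyAlpha`), proved by induction with a telescoping certificate; the
conjugate Bailey pair is the `q`-Gauss sum (`qGauss`), proved by a telescoping relation between its
values at `w` and `wq` and a limit along `w q ^ N`.
-/

/-! ### Finite and infinite `q`-shifted factorials -/

theorem qPoch_zero (v q : ℂ) : qPoch v q 0 = 1 := by simp [qPoch]

theorem qPoch_succ (v q : ℂ) (n : ℕ) : qPoch v q (n + 1) = qPoch v q n * (1 - v * q ^ n) := by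
  simp [qPoch, Finset.prod_range_succ]

theorem qPoch_add (v q : ℂ) (m n : ℕ) :
    qPoch v q (m + n) = qPoch v q m * qPoch (v * q ^ m) q n := by
  simp only [qPoch, Finset.prod_range_add, pow_add, mul_assoc]

theorem one_sub_mul_qPoch (v q : ℂ) (n : ℕ) :
    (1 - v) * qPoch (v * q) q n = qPoch v q n * (1 - v * q ^ n) := by
  have h := qPoch_add v q 1 n
  rw [add_comm, qPoch_succ] at h
  simpa [qPoch] using h.symm

theorem one_sub_mul_pow_ne_zero {v q : ℂ} (hq : ‖q‖ < 1) (hv : ‖v‖ < 1) (n : ℕ) :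
    1 - v * q ^ n ≠ 0 := by
  intro h
  have h1 : ‖v * q ^ n‖ < 1 := by
    rw [norm_mul, norm_pow]
    exact mul_lt_one_of_nonneg_of_lt_one_left (norm_nonneg _) hv
      (pow_le_one₀ (norm_nonneg _) hq.le)
  rw [← sub_eq_zero.mp h] at h1
  simp at h1

theorem qPoch_ne_zero {v q : ℂ} (hq : ‖q‖ < 1) (hv : ‖v‖ < 1) (n : ℕ) : qPoch v q n ≠ 0 :=
  Finset.prod_ne_zero_iff.mpr fun k _ => one_sub_mul_pow_ne_zero hq hv k

theorem tendsto_qPoch (v : ℂ) {q : ℂ} (hq : ‖q‖ < 1) :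
    Filter.Tendsto (qPoch v q) Filter.atTop (nhds (qPochInf v q)) :=
  (multipliable_qPochInf v hq).hasProd.tendsto_prod_nat

theorem qPochInf_eq_mul (v : ℂ) {q : ℂ} (hq : ‖q‖ < 1) (m : ℕ) :
    qPochInf v q = qPoch v q m * qPochInf (v * q ^ m) q := by
  refine tendsto_nhds_unique
    ((tendsto_qPoch v hq).comp (Filter.tendsto_add_atTop_nat m)) ?_
  refine ((tendsto_qPoch (v * q ^ m) hq).const_mul (qPoch v q m)).congr fun n => ?_
  rw [Function.comp_apply, add_comm, qPoch_add]

theorem exists_norm_qPoch_le {q : ℂ} (hq : ‖q‖ < 1) (v : ℂ) :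
    ∃ K : ℝ, 0 ≤ K ∧ ∀ n, ‖qPoch v q n‖ ≤ K := by
  obtain ⟨K, hK⟩ := (tendsto_qPoch v hq).norm.bddAbove_range
  exact ⟨K, (norm_nonneg _).trans (hK ⟨0, rfl⟩), fun n => hK ⟨n, rfl⟩⟩

/-- The bound is uniform over the disc `‖v‖ ≤ ρ`, so that it applies at once to all the shifted
parameters `v * q ^ m`. -/
theorem exists_norm_inv_qPoch_le {q : ℂ} (hq : ‖q‖ < 1) {ρ : ℝ} (hρ : ρ < 1) :
    ∃ K : ℝ, 0 ≤ K ∧ ∀ v : ℂ, ‖v‖ ≤ ρ → ∀ n, ‖(qPoch v q n)⁻¹‖ ≤ K := by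
  refine ⟨Real.exp (∑' k : ℕ, ‖q‖ ^ k / (1 - ρ)), (Real.exp_pos _).le, fun v hv n => ?_⟩
  have hs : Summable fun k : ℕ => ‖q‖ ^ k / (1 - ρ) :=
    (summable_geometric_of_lt_one (norm_nonneg q) hq).div_const _
  have hρ' : 0 < 1 - ρ := by linarith
  have hk : ∀ k : ℕ, ‖(1 - v * q ^ k)⁻¹‖ ≤ Real.exp (‖q‖ ^ k / (1 - ρ)) := by
    intro k
    have h0 : 0 ≤ ‖q‖ ^ k := by positivity
    have h1 : ‖q‖ ^ k ≤ 1 := pow_le_one₀ (norm_nonneg _) hq.le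
    have h2 : 1 - ρ * ‖q‖ ^ k ≤ ‖1 - v * q ^ k‖ := by
      have := norm_sub_norm_le 1 (v * q ^ k)
      rw [norm_one, norm_mul, norm_pow] at this
      nlinarith
    have hρ0 : 0 ≤ ρ := (norm_nonneg v).trans hv
    have h3 : 0 < 1 - ρ * ‖q‖ ^ k := by nlinarith
    rw [norm_inv]
    calc ‖1 - v * q ^ k‖⁻¹ ≤ (1 - ρ * ‖q‖ ^ k)⁻¹ := inv_anti₀ h3 h2
      _ ≤ ‖q‖ ^ k / (1 - ρ) + 1 := by
        rw [inv_le_iff_one_le_mul₀ h3, div_add_one hρ'.ne', div_mul_eq_mul_div,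
          le_div_iff₀ hρ']
        nlinarith [mul_nonneg h0 hρ'.le, mul_nonneg (mul_nonneg h0 hρ0) (sub_nonneg.mpr h1)]
      _ ≤ _ := Real.add_one_le_exp _
  rw [qPoch, ← Finset.prod_inv_distrib, norm_prod]
  calc ∏ k ∈ Finset.range n, ‖(1 - v * q ^ k)⁻¹‖
      ≤ ∏ k ∈ Finset.range n, Real.exp (‖q‖ ^ k / (1 - ρ)) :=
        Finset.prod_le_prod (fun _ _ => norm_nonneg _) fun k _ => hk k
    _ = Real.exp (∑ k ∈ Finset.range n, ‖q‖ ^ k / (1 - ρ)) := (Real.exp_sum _ _).symm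
    _ ≤ _ := Real.exp_le_exp.mpr (hs.sum_le_tsum _ fun k _ => by positivity)

theorem qPochInf_ne_zero {v q : ℂ} (hq : ‖q‖ < 1) (hv : ‖v‖ < 1) : qPochInf v q ≠ 0 := by
  obtain ⟨K, hK0, hK⟩ := exists_norm_inv_qPoch_le hq hv
  intro h
  have h1 := ((tendsto_qPoch v hq).norm).const_mul K
  rw [h, norm_zero, mul_zero] at h1
  refine absurd (ge_of_tendsto' h1 fun n => ?_) (not_le.mpr one_pos)
  have h2 := mul_le_mul_of_nonneg_right (hK v le_rfl n) (norm_nonneg (qPoch v q n))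
  rwa [← norm_mul, inv_mul_cancel₀ (qPoch_ne_zero hq hv n), norm_one] at h2

theorem norm_mul_lt_one {x y : ℂ} (hx : ‖x‖ < 1) (hy : ‖y‖ < 1) : ‖x * y‖ < 1 := by
  rw [norm_mul]
  exact mul_lt_one_of_nonneg_of_lt_one_left (norm_nonneg _) hx hy.le

theorem norm_mul_pow_le {q : ℂ} (hq : ‖q‖ < 1) (v : ℂ) (m : ℕ) : ‖v * q ^ m‖ ≤ ‖v‖ := by
  rw [norm_mul, norm_pow]
  exact mul_le_of_le_one_right (norm_nonneg _) (pow_le_one₀ (norm_nonneg _) hq.le)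

/-! ### The `q`-Gauss sum -/

theorem summable_norm_qGauss {q x y w v : ℂ} (hq : ‖q‖ < 1) (hw : ‖w‖ < 1) (hv : ‖v‖ < 1) :
    Summable fun n => ‖qPoch x q n * qPoch y q n * w ^ n / (qPoch q q n * qPoch v q n)‖ := by
  obtain ⟨K₁, h₁, hK₁⟩ := exists_norm_qPoch_le hq x
  obtain ⟨K₂, h₂, hK₂⟩ := exists_norm_qPoch_le hq y
  obtain ⟨K₃, h₃, hK₃⟩ := exists_norm_inv_qPoch_le hq hq
  obtain ⟨K₄, h₄, hK₄⟩ := exists_norm_inv_qPoch_le hq hv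
  refine Summable.of_nonneg_of_le (fun _ => norm_nonneg _) (fun n => ?_)
    ((summable_geometric_of_lt_one (norm_nonneg w) hw).mul_left (K₁ * K₂ * K₃ * K₄))
  have e : qPoch x q n * qPoch y q n * w ^ n / (qPoch q q n * qPoch v q n) =
    qPoch x q n * qPoch y q n * (qPoch q q n)⁻¹ * (qPoch v q n)⁻¹ * w ^ n := by
    rw [div_eq_mul_inv, mul_inv]; ring
  rw [e]
  simp only [norm_mul, norm_pow]
  gcongr
  exacts [hK₁ n, hK₂ n, hK₃ q le_rfl n, hK₄ v le_rfl n]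

/-- The telescoping identity behind `qGauss_step`; the right-hand side tends to `0`. -/
theorem qGauss_telescoping {q x y w : ℂ} (hq : ‖q‖ < 1) (hv : ‖x * y * w‖ < 1) (N : ℕ) :
    ∑ n ∈ Finset.range (N + 1),
      ((1 - x * y * w) * (1 - w) *
          (qPoch x q n * qPoch y q n * w ^ n / (qPoch q q n * qPoch (x * y * w) q n)) -
        (1 - x * w) * (1 - y * w) *
          (qPoch x q n * qPoch y q n * (w * q) ^ n /
            (qPoch q q n * qPoch (x * y * (w * q)) q n))) =
      -(w ^ (N + 1) * qPoch x q (N + 1) * qPoch y q (N + 1) /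
        (qPoch q q N * qPoch (x * y * (w * q)) q N)) := by
  generalize hxy : x * y * w = v at *
  have hvq : ‖v * q‖ < 1 := norm_mul_lt_one hv hq
  have e : x * y * (w * q) = v * q := by rw [← hxy]; ring
  rw [e]
  -- the two denominators are compared through `(v; q)_n (1 - v q ^ n) = (1 - v) (v q; q)_n`
  have key : ∀ n, qPoch v q n = (1 - v) * qPoch (v * q) q n / (1 - v * q ^ n) := fun n => by
    rw [eq_div_iff (one_sub_mul_pow_ne_zero hq hv n), ← one_sub_mul_qPoch]
  have hv0 : 1 - v ≠ 0 := by simpa using one_sub_mul_pow_ne_zero hq hv 0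
  induction N with
  | zero => simp [qPoch]; rw [← hxy]; ring
  | succ N ih =>
    rw [Finset.sum_range_succ, ih, key]
    have h1 := one_sub_mul_pow_ne_zero hq hv (N + 1)
    have h2 := one_sub_mul_pow_ne_zero hq hq N
    have e1 : 1 - v * q * q ^ N = 1 - v * q ^ (N + 1) := by ring
    have h4 := qPoch_ne_zero hq hq N
    have h5 := qPoch_ne_zero hq hvq N
    clear ih key
    simp only [qPoch_succ, e1]
    generalize hA : 1 - v * q ^ (N + 1) = A at *
    generalize hB : 1 - q * q ^ N = B at *
    generalize hC : 1 - v = C at *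
    field_simp
    rw [← hA, ← hB, ← hxy]
    ring

theorem qGauss_step {q x y w : ℂ} (hq : ‖q‖ < 1) (hw : ‖w‖ < 1) (hv : ‖x * y * w‖ < 1) :
    (1 - x * y * w) * (1 - w) *
        ∑' n, qPoch x q n * qPoch y q n * w ^ n / (qPoch q q n * qPoch (x * y * w) q n) =
      (1 - x * w) * (1 - y * w) *
        ∑' n, qPoch x q n * qPoch y q n * (w * q) ^ n /
          (qPoch q q n * qPoch (x * y * (w * q)) q n) := by
  have hvq : ‖x * y * (w * q)‖ < 1 := by
    rw [← mul_assoc]; exact norm_mul_lt_one hv hq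
  have s1 := (summable_norm_qGauss (x := x) (y := y) hq hw hv).of_norm.mul_left
    ((1 - x * y * w) * (1 - w))
  have s2 := (summable_norm_qGauss (x := x) (y := y) hq (norm_mul_lt_one hw hq)
    hvq).of_norm.mul_left ((1 - x * w) * (1 - y * w))
  rw [← tsum_mul_left, ← tsum_mul_left, ← sub_eq_zero, ← s1.tsum_sub s2]
  refine tendsto_nhds_unique
    (((s1.sub s2).hasSum.tendsto_sum_nat).comp (Filter.tendsto_add_atTop_nat 1)) ?_
  refine Filter.Tendsto.congr (fun N => (qGauss_telescoping hq hv N).symm) ?_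
  have hx := (tendsto_qPoch x hq).comp (Filter.tendsto_add_atTop_nat 1)
  have hy := (tendsto_qPoch y hq).comp (Filter.tendsto_add_atTop_nat 1)
  have hwt := (tendsto_pow_atTop_nhds_zero_of_norm_lt_one hw).comp
    (Filter.tendsto_add_atTop_nat 1)
  have hd := (tendsto_qPoch q hq).mul (tendsto_qPoch (x * y * (w * q)) hq)
  have := (((hwt.mul hx).mul hy).div hd
    (mul_ne_zero (qPochInf_ne_zero hq hq) (qPochInf_ne_zero hq hvq))).neg
  simpa using this

theorem qGauss_iterate {q x y w : ℂ} (hq : ‖q‖ < 1) (hw : ‖w‖ < 1) (hv : ‖x * y * w‖ < 1)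
    (N : ℕ) :
    qPoch (x * y * w) q N * qPoch w q N *
        ∑' n, qPoch x q n * qPoch y q n * w ^ n / (qPoch q q n * qPoch (x * y * w) q n) =
      qPoch (x * w) q N * qPoch (y * w) q N *
        ∑' n, qPoch x q n * qPoch y q n * (w * q ^ N) ^ n /
          (qPoch q q n * qPoch (x * y * (w * q ^ N)) q n) := by
  induction N with
  | zero => simp [qPoch]
  | succ N ih =>
    have h := qGauss_step (q := q) (x := x) (y := y) (w := w * q ^ N) hq
      ((norm_mul_pow_le hq w N).trans_lt hw)
      (by rw [← mul_assoc]; exact (norm_mul_pow_le hq _ N).trans_lt hv)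
    rw [pow_succ, ← mul_assoc w]
    simp only [qPoch_succ]
    linear_combination (1 - x * y * w * q ^ N) * (1 - w * q ^ N) * ih +
      qPoch (x * w) q N * qPoch (y * w) q N * h

/-- The `q`-Gauss sum `₂φ₁(x, y; xyw; q, w) = (xw, yw; q)_∞ / (xyw, w; q)_∞`, obtained by letting
`N → ∞` in `qGauss_iterate`: the series at `w q ^ N` tends to its term at `n = 0`. -/
theorem qGauss {q x y w : ℂ} (hq : ‖q‖ < 1) (hw : ‖w‖ < 1) (hv : ‖x * y * w‖ < 1) :
    qPochInf (x * y * w) q * qPochInf w q *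
        ∑' n, qPoch x q n * qPoch y q n * w ^ n / (qPoch q q n * qPoch (x * y * w) q n) =
      qPochInf (x * w) q * qPochInf (y * w) q := by
  obtain ⟨K₁, h₁, hK₁⟩ := exists_norm_qPoch_le hq x
  obtain ⟨K₂, h₂, hK₂⟩ := exists_norm_qPoch_le hq y
  obtain ⟨K₃, h₃, hK₃⟩ := exists_norm_inv_qPoch_le hq hq
  obtain ⟨K₄, h₄, hK₄⟩ := exists_norm_inv_qPoch_le hq hv
  have hlim : Filter.Tendsto (fun N => ∑' n, qPoch x q n * qPoch y q n * (w * q ^ N) ^ n /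
      (qPoch q q n * qPoch (x * y * (w * q ^ N)) q n)) Filter.atTop
      (nhds (∑' n, if n = 0 then (1 : ℂ) else 0)) := by
    refine tendsto_tsum_of_dominated_convergence
      ((summable_geometric_of_lt_one (norm_nonneg w) hw).mul_left (K₁ * K₂ * K₃ * K₄)) ?_ ?_
    · intro n
      rcases n with _ | n
      · simp [qPoch]
      · rw [if_neg n.succ_ne_zero]
        refine squeeze_zero_norm (a := fun N => K₁ * K₂ * K₃ * K₄ * ‖q ^ N‖) (fun N => ?_) ?_
        · have hle : ‖w * q ^ N‖ ^ (n + 1) ≤ ‖q ^ N‖ := by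
            have h1 : ‖w * q ^ N‖ ≤ ‖q ^ N‖ := by
              rw [norm_mul]; exact mul_le_of_le_one_left (norm_nonneg _) hw.le
            have h2 : ‖w * q ^ N‖ ≤ 1 := ((norm_mul_pow_le hq w N).trans_lt hw).le
            exact (pow_le_of_le_one (norm_nonneg _) h2 n.succ_ne_zero).trans h1
          rw [div_eq_mul_inv, mul_inv]
          calc _ = ‖qPoch x q (n + 1)‖ * ‖qPoch y q (n + 1)‖ * ‖(qPoch q q (n + 1))⁻¹‖ *
                ‖(qPoch (x * y * (w * q ^ N)) q (n + 1))⁻¹‖ * ‖w * q ^ N‖ ^ (n + 1) := by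
                simp only [norm_mul, norm_pow]; ring
            _ ≤ _ := by
              gcongr
              exacts [hK₁ _, hK₂ _, hK₃ q le_rfl _, hK₄ _
                (by rw [← mul_assoc]; exact norm_mul_pow_le hq _ N) _]
        · simpa using (tendsto_pow_atTop_nhds_zero_of_norm_lt_one hq).norm.const_mul
            (K₁ * K₂ * K₃ * K₄)
    · refine Filter.Eventually.of_forall fun N n => ?_
      rw [div_eq_mul_inv, mul_inv]
      calc _ = ‖qPoch x q n‖ * ‖qPoch y q n‖ * ‖(qPoch q q n)⁻¹‖ *
            ‖(qPoch (x * y * (w * q ^ N)) q n)⁻¹‖ * ‖w * q ^ N‖ ^ n := by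
            simp only [norm_mul, norm_pow]; ring
        _ ≤ _ := by
          gcongr
          exacts [hK₁ _, hK₂ _, hK₃ q le_rfl _, hK₄ _
            (by rw [← mul_assoc]; exact norm_mul_pow_le hq _ N) _, norm_mul_pow_le hq _ N]
  rw [tsum_ite_eq] at hlim
  have hl := ((tendsto_qPoch (x * y * w) hq).mul (tendsto_qPoch w hq)).mul_const
    (∑' n, qPoch x q n * qPoch y q n * w ^ n / (qPoch q q n * qPoch (x * y * w) q n))
  have hr := ((tendsto_qPoch (x * w) hq).mul (tendsto_qPoch (y * w) hq)).mul hlim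
  rw [mul_one] at hr
  exact tendsto_nhds_unique hl (hr.congr fun N => (qGauss_iterate hq hw hv N).symm)

/-! ### The terminating very-well-poised sum -/

theorem pow_triangle_succ (q : ℂ) (m : ℕ) :
    q ^ ((m + 1) * (m + 1 - 1) / 2) = q ^ (m * (m - 1) / 2) * q ^ m := by
  rw [← pow_add, Nat.triangle_succ]

/-- The `α`-sequence of the Bailey pair relative to `A = xyu / q` whose `β`-sequence is
`(u; q)_j / (q, yu, xu; q)_j`; see `sum_baileyAlpha`. -/
noncomputable def baileyAlpha (q A x y u : ℂ) (m : ℕ) : ℂ :=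
  (1 - A * q ^ (2 * m)) * (qPoch A q m * qPoch x q m * qPoch y q m) /
      ((1 - A) * (qPoch q q m * qPoch (y * u) q m * qPoch (x * u) q m)) *
    (-u) ^ m * q ^ (m * (m - 1) / 2)

/-- A telescoping (WZ-style) certificate for the recurrence in `j` of the sum in
`sum_baileyAlpha`. -/
theorem sum_baileyAlpha_telescoping {q A x y u : ℂ} (hq : ‖q‖ < 1) (hq0 : q ≠ 0)
    (hA : A = x * y * u / q) (hA1 : A ≠ 1) (hyu : ‖y * u‖ < 1) (hxu : ‖x * u‖ < 1)
    (hxyu : ‖x * y * u‖ < 1) (j M : ℕ) (hM : M ≤ j) :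
    ∑ m ∈ Finset.range (M + 1),
      ((1 - q * q ^ j) * (1 - y * u * q ^ j) * (1 - x * u * q ^ j) *
          (baileyAlpha q A x y u m / (qPoch q q (j + 1 - m) * qPoch (x * y * u) q (j + 1 + m))) -
        (1 - u * q ^ j) *
          (baileyAlpha q A x y u m / (qPoch q q (j - m) * qPoch (x * y * u) q (j + m)))) =
      u * q ^ j * (qPoch A q (M + 1) * qPoch x q (M + 1) * qPoch y q (M + 1)) /
          ((1 - A) * (qPoch q q M * qPoch (y * u) q M * qPoch (x * u) q M)) *
        (-u) ^ M * q ^ (M * (M - 1) / 2) /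
          (qPoch q q (j - M) * qPoch (x * y * u) q (j + M + 1)) := by
  have hA1' : 1 - A ≠ 0 := sub_ne_zero.mpr (Ne.symm hA1)
  induction M with
  | zero =>
    have h1 := one_sub_mul_pow_ne_zero hq hq j
    have h2 := one_sub_mul_pow_ne_zero hq hxyu j
    have h3 := qPoch_ne_zero hq hq j
    have h4 := qPoch_ne_zero hq hxyu j
    simp only [zero_add, Finset.sum_range_one, baileyAlpha, qPoch_succ, qPoch_zero, Nat.sub_zero,
      add_zero, mul_zero, pow_zero, mul_one, Nat.zero_div, one_mul, zero_mul]
    generalize hB : 1 - x * y * u * q ^ j = B at *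
    generalize hC : 1 - q * q ^ j = C at *
    field_simp
    rw [← hB]
    ring
  | succ M ih =>
    rw [Finset.sum_range_succ, ih (by omega)]
    obtain ⟨e, rfl⟩ := Nat.exists_eq_add_of_le hM
    have i1 : M + 1 + e - M = e + 1 := by omega
    have i2 : M + 1 + e + 1 - (M + 1) = e + 1 := by omega
    have i3 : M + 1 + e - (M + 1) = e := by omega
    have i4 : M + 1 + e + 1 + (M + 1) = M + 1 + e + M + 1 + 1 := by omega
    have i5 : M + 1 + e + (M + 1) = M + 1 + e + M + 1 := by omega
    rw [i1, i2, i3, i4, i5]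
    have h1 := qPoch_ne_zero hq hq e
    have h2 := one_sub_mul_pow_ne_zero hq hq e
    have h3 := qPoch_ne_zero hq hq M
    have h4 := one_sub_mul_pow_ne_zero hq hq M
    have h5 := qPoch_ne_zero hq hyu M
    have h6 := one_sub_mul_pow_ne_zero hq hyu M
    have h7 := qPoch_ne_zero hq hxu M
    have h8 := one_sub_mul_pow_ne_zero hq hxu M
    have h9 := qPoch_ne_zero hq hxyu (M + 1 + e + M + 1)
    have h10 := one_sub_mul_pow_ne_zero hq hxyu (M + 1 + e + M + 1)
    clear ih
    simp only [baileyAlpha, pow_triangle_succ]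
    rw [qPoch_succ (x * y * u) q (M + 1 + e + M + 1)]
    generalize qPoch (x * y * u) q (M + 1 + e + M + 1) = V at *
    simp only [qPoch_succ]
    generalize hB : 1 - x * y * u * q ^ (M + 1 + e + M + 1) = B at *
    generalize hC : 1 - q * q ^ e = C at *
    generalize hD : 1 - q * q ^ M = D at *
    generalize hE : 1 - y * u * q ^ M = E at *
    generalize hF : 1 - x * u * q ^ M = F at *
    generalize hG : 1 - A = G at *
    generalize qPoch A q M = f1 at *
    generalize qPoch x q M = f2 at *
    generalize qPoch y q M = f3 at *
    generalize qPoch q q M = f4 at *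
    generalize qPoch q q e = f5 at *
    generalize qPoch (y * u) q M = f6 at *
    generalize qPoch (x * u) q M = f7 at *
    generalize q ^ (M * (M - 1) / 2) = T
    rw [hA]
    have p1 : q ^ (M + 1 + e) = q ^ M * q * q ^ e := by ring
    have p2 : q ^ (2 * (M + 1)) = (q ^ M) ^ 2 * q ^ 2 := by ring
    have p3 : q ^ (M + 1 + e + M + 1) = (q ^ M) ^ 2 * q ^ 2 * q ^ e := by ring
    rw [p3] at hB
    rw [p1, p2, pow_succ (-u), pow_succ q M]
    generalize (-u) ^ M = U
    generalize q ^ M = Q at *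
    generalize q ^ e = R at *
    field_simp
    rw [← hB, ← hC, ← hD, ← hE, ← hF]
    ring

/-- A form of the terminating `₆φ₅` sum. -/
theorem sum_baileyAlpha {q A x y u : ℂ} (hq : ‖q‖ < 1) (hq0 : q ≠ 0)
    (hA : A = x * y * u / q) (hA1 : A ≠ 1) (hyu : ‖y * u‖ < 1) (hxu : ‖x * u‖ < 1)
    (hxyu : ‖x * y * u‖ < 1) (j : ℕ) :
    ∑ m ∈ Finset.range (j + 1),
        baileyAlpha q A x y u m / (qPoch q q (j - m) * qPoch (x * y * u) q (j + m)) =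
      qPoch u q j / (qPoch q q j * qPoch (y * u) q j * qPoch (x * u) q j) := by
  have hA1' : 1 - A ≠ 0 := sub_ne_zero.mpr (Ne.symm hA1)
  induction j with
  | zero => simp [baileyAlpha, qPoch, hA1']
  | succ j ih =>
    have h1 := one_sub_mul_pow_ne_zero hq hq j
    have h2 := one_sub_mul_pow_ne_zero hq hyu j
    have h3 := one_sub_mul_pow_ne_zero hq hxu j
    have h4 := qPoch_ne_zero hq hq j
    have h5 := qPoch_ne_zero hq hyu j
    have h6 := qPoch_ne_zero hq hxu j
    have h7 := qPoch_ne_zero hq hxyu (j + j + 1)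
    have h8 := one_sub_mul_pow_ne_zero hq hxyu (j + j + 1)
    have key := sum_baileyAlpha_telescoping hq hq0 hA hA1 hyu hxu hxyu j j le_rfl
    rw [Finset.sum_sub_distrib, ← Finset.mul_sum, ← Finset.mul_sum, ih, sub_eq_iff_eq_add] at key
    -- the last term of the new sum cancels against the boundary term of the telescoping
    have last : (1 - q * q ^ j) * (1 - y * u * q ^ j) * (1 - x * u * q ^ j) *
          (baileyAlpha q A x y u (j + 1) /
            (qPoch q q (j + 1 - (j + 1)) * qPoch (x * y * u) q (j + 1 + (j + 1)))) =
        -(u * q ^ j * (qPoch A q (j + 1) * qPoch x q (j + 1) * qPoch y q (j + 1)) /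
          ((1 - A) * (qPoch q q j * qPoch (y * u) q j * qPoch (x * u) q j)) *
        (-u) ^ j * q ^ (j * (j - 1) / 2) /
          (qPoch q q (j - j) * qPoch (x * y * u) q (j + j + 1))) := by
      have i1 : j + 1 + (j + 1) = j + j + 1 + 1 := by omega
      have p : A * q ^ (2 * (j + 1)) = x * y * u * q ^ (j + j + 1) := by
        rw [hA]; field_simp; ring
      rw [i1, qPoch_succ (x * y * u) q (j + j + 1)]
      simp only [baileyAlpha, pow_triangle_succ, Nat.sub_self, qPoch_zero, p]
      rw [qPoch_succ q, qPoch_succ (y * u), qPoch_succ (x * u), pow_succ (-u)]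
      generalize 1 - x * y * u * q ^ (j + j + 1) = B at *
      generalize 1 - q * q ^ j = C at *
      generalize 1 - y * u * q ^ j = D at *
      generalize 1 - x * u * q ^ j = E at *
      generalize 1 - A = G at *
      field_simp
    have hne : (1 - q * q ^ j) * (1 - y * u * q ^ j) * (1 - x * u * q ^ j) ≠ 0 :=
      mul_ne_zero (mul_ne_zero h1 h2) h3
    refine mul_left_cancel₀ hne ?_
    rw [Finset.sum_range_succ, mul_add, last, key]
    simp only [qPoch_succ]
    generalize 1 - q * q ^ j = C at *
    generalize 1 - y * u * q ^ j = D at *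
    generalize 1 - x * u * q ^ j = E at *
    field_simp
    ring

/-! ### Bounded coefficients and absolutely convergent double series -/

theorem exists_norm_mul_le {ι : Type*} {f g : ι → ℂ} (hf : ∃ K : ℝ, ∀ i, ‖f i‖ ≤ K)
    (hg : ∃ K : ℝ, ∀ i, ‖g i‖ ≤ K) : ∃ K : ℝ, ∀ i, ‖f i * g i‖ ≤ K := by
  obtain ⟨K, hK⟩ := hf
  obtain ⟨K', hK'⟩ := hg
  refine ⟨K * K', fun i => ?_⟩
  rw [norm_mul]
  exact mul_le_mul (hK i) (hK' i) (norm_nonneg _) ((norm_nonneg _).trans (hK i))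

theorem exists_norm_const_le {ι : Type*} (c : ℂ) : ∃ K : ℝ, ∀ _ : ι, ‖c‖ ≤ K :=
  ⟨‖c‖, fun _ => le_rfl⟩

theorem exists_norm_pow_comp_le {ι : Type*} {q : ℂ} (hq : ‖q‖ ≤ 1) (g : ι → ℕ) :
    ∃ K : ℝ, ∀ i, ‖q ^ g i‖ ≤ K :=
  ⟨1, fun i => by rw [norm_pow]; exact pow_le_one₀ (norm_nonneg _) hq⟩

theorem exists_norm_one_sub_mul_pow_comp_le {ι : Type*} {q : ℂ} (hq : ‖q‖ < 1) (A : ℂ)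
    (g : ι → ℕ) : ∃ K : ℝ, ∀ i, ‖1 - A * q ^ g i‖ ≤ K :=
  ⟨‖(1 : ℂ)‖ + ‖A‖, fun i => (norm_sub_le _ _).trans (by
    gcongr; exact norm_mul_pow_le hq A (g i))⟩

theorem exists_norm_qPoch_comp_le {ι : Type*} {q : ℂ} (hq : ‖q‖ < 1) (v : ℂ) (g : ι → ℕ) :
    ∃ K : ℝ, ∀ i, ‖qPoch v q (g i)‖ ≤ K := by
  obtain ⟨K, -, hK⟩ := exists_norm_qPoch_le hq v
  exact ⟨K, fun i => hK (g i)⟩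

theorem exists_norm_inv_qPoch_comp_le {ι : Type*} {q v : ℂ} (hq : ‖q‖ < 1) (hv : ‖v‖ < 1)
    (g : ι → ℕ) : ∃ K : ℝ, ∀ i, ‖(qPoch v q (g i))⁻¹‖ ≤ K := by
  obtain ⟨K, -, hK⟩ := exists_norm_inv_qPoch_le hq hv
  exact ⟨K, fun i => hK v le_rfl (g i)⟩

theorem summable_norm_mul_of_bounded {ι : Type*} {f g : ι → ℂ} (hf : ∃ K : ℝ, ∀ i, ‖f i‖ ≤ K)
    (hg : Summable fun i => ‖g i‖) : Summable fun i => ‖f i * g i‖ := by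
  obtain ⟨K, hK⟩ := hf
  refine Summable.of_nonneg_of_le (fun _ => norm_nonneg _) (fun i => ?_) (hg.mul_left K)
  rw [norm_mul]
  exact mul_le_mul_of_nonneg_right (hK i) (norm_nonneg _)

theorem summable_norm_pow_mul_pow {u w : ℂ} (hu : ‖u‖ < 1) (hw : ‖w‖ < 1) :
    Summable fun p : ℕ × ℕ => ‖u ^ p.1 * w ^ p.2‖ := by
  simp only [norm_mul, norm_pow]
  exact (summable_geometric_of_lt_one (norm_nonneg u) hu).mul_of_nonneg
    (summable_geometric_of_lt_one (norm_nonneg w) hw) (fun _ => by positivity)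
    fun _ => by positivity

theorem summable_norm_tsum_prod {T : ℕ × ℕ → ℂ} (hT : Summable fun p => ‖T p‖) :
    Summable fun m => ‖∑' n, T (m, n)‖ :=
  Summable.of_nonneg_of_le (fun _ => norm_nonneg _)
    (fun m => norm_tsum_le_tsum_norm (hT.prod_factor m)) hT.prod

theorem summable_norm_sum_antidiagonal {T : ℕ × ℕ → ℂ} (hT : Summable fun p => ‖T p‖) :
    Summable fun n => ‖∑ p ∈ Finset.HasAntidiagonal.antidiagonal n, T p‖ := by
  have h := (Finset.HasAntidiagonal.sigmaAntidiagonalEquivProd.summable_iff (f := fun p => ‖T p‖)).mpr hT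
  refine Summable.of_nonneg_of_le (fun _ => norm_nonneg _) (fun n => norm_sum_le _ _) ?_
  refine h.sigma.congr fun n => ?_
  simp only [Function.comp_apply, Finset.HasAntidiagonal.sigmaAntidiagonalEquivProd_apply]
  exact Finset.tsum_subtype (Finset.HasAntidiagonal.antidiagonal n) fun p => ‖T p‖

theorem tsum_sum_antidiagonal {T : ℕ × ℕ → ℂ} (hT : Summable fun p => ‖T p‖) :
    ∑' n, ∑ p ∈ Finset.HasAntidiagonal.antidiagonal n, T p = ∑' m, ∑' n, T (m, n) := by
  have h := (Finset.HasAntidiagonal.sigmaAntidiagonalEquivProd.summable_iff (f := T)).mpr hT.of_norm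
  rw [← hT.of_norm.tsum_prod, ← Finset.HasAntidiagonal.sigmaAntidiagonalEquivProd.tsum_eq T]
  rw [Summable.tsum_sigma (f := fun c => T (Finset.HasAntidiagonal.sigmaAntidiagonalEquivProd c)) h]
  refine tsum_congr fun n => ?_
  simp only [Finset.HasAntidiagonal.sigmaAntidiagonalEquivProd_apply]
  exact (Finset.tsum_subtype (Finset.HasAntidiagonal.antidiagonal n) T).symm

/-! ### The non-terminating limit of Watson's transformation -/

/-- The conjugate Bailey pair of the `q`-Gauss sum, in the parameters of `watson_limit`. -/
theorem tsum_qGauss_shift {q a b c d r : ℂ} (hq : ‖q‖ < 1) (hdr : ‖d * r‖ < 1)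
    (hP : ‖a * d * (a * r) * (b * c)‖ < 1) (habdr : ‖a * b * d * r‖ < 1)
    (hacdr : ‖a * c * d * r‖ < 1) (m : ℕ) :
    qPochInf (a * d * (a * r) * (b * c)) q * qPochInf (d * r) q *
        ∑' n, qPoch (a * b) q (m + n) * qPoch (a * c) q (m + n) * (d * r) ^ (m + n) /
          (qPoch q q n * qPoch (a * d * (a * r) * (b * c)) q (m + n + m)) =
      qPochInf (a * b * d * r) q * qPochInf (a * c * d * r) q *
        (qPoch (a * b) q m * qPoch (a * c) q m * (d * r) ^ m /
          (qPoch (a * b * d * r) q m * qPoch (a * c * d * r) q m)) := by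
  set P := a * d * (a * r) * (b * c) with hPdef
  have e : a * b * q ^ m * (a * c * q ^ m) * (d * r) = P * q ^ (m + m) := by
    rw [hPdef]; ring
  have hg := qGauss (x := a * b * q ^ m) (y := a * c * q ^ m) (w := d * r) hq hdr
    (by rw [e]; exact (norm_mul_pow_le hq P _).trans_lt hP)
  have e1 : a * b * q ^ m * (d * r) = a * b * d * r * q ^ m := by ring
  have e2 : a * c * q ^ m * (d * r) = a * c * d * r * q ^ m := by ring
  rw [e, e1, e2] at hg
  have ht : ∑' n, qPoch (a * b) q (m + n) * qPoch (a * c) q (m + n) * (d * r) ^ (m + n) /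
        (qPoch q q n * qPoch P q (m + n + m)) =
      qPoch (a * b) q m * qPoch (a * c) q m * (d * r) ^ m / qPoch P q (m + m) *
        ∑' n, qPoch (a * b * q ^ m) q n * qPoch (a * c * q ^ m) q n * (d * r) ^ n /
          (qPoch q q n * qPoch (P * q ^ (m + m)) q n) := by
    rw [← tsum_mul_left]
    refine tsum_congr fun n => ?_
    rw [show m + n + m = m + m + n by omega, qPoch_add (a * b), qPoch_add (a * c), qPoch_add P,
      pow_add, div_mul_div_comm]
    congr 1 <;> ring
  have h1 := qPoch_ne_zero hq hP (m + m)
  have h2 := qPoch_ne_zero hq habdr m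
  have h3 := qPoch_ne_zero hq hacdr m
  rw [ht, qPochInf_eq_mul P hq (m + m), qPochInf_eq_mul (a * b * d * r) hq m,
    qPochInf_eq_mul (a * c * d * r) hq m]
  generalize ∑' n, qPoch (a * b * q ^ m) q n * qPoch (a * c * q ^ m) q n * (d * r) ^ n /
          (qPoch q q n * qPoch (P * q ^ (m + m)) q n) = S at *
  generalize qPoch (a * b * d * r) q m = f₁ at *
  generalize qPoch (a * c * d * r) q m = f₂ at *
  generalize qPochInf (a * b * d * r * q ^ m) q = g₁ at *
  generalize qPochInf (a * c * d * r * q ^ m) q = g₂ at *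
  generalize qPochInf (d * r) q = g₃ at *
  generalize d * r = w
  field_simp
  linear_combination qPoch (a * b) q m * qPoch (a * c) q m * w ^ m * hg

/-- The non-terminating limit `n → ∞` of Watson's `₈φ₇` transformation. It is Bailey's lemma for
the pair of `sum_baileyAlpha` and the conjugate pair of `tsum_qGauss_shift`: both sides sum one
absolutely convergent double series, by antidiagonals and by rows. -/
theorem watson_limit {q a b c d r A : ℂ} (hq : ‖q‖ < 1) (hq0 : q ≠ 0)
    (ha : ‖a‖ < 1) (hb : ‖b‖ < 1) (hc : ‖c‖ < 1) (hd : ‖d‖ < 1) (hr : ‖r‖ < 1)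
    (hA : A = a * d * (a * r) * (b * c) / q) (hA1 : A ≠ 1) :
    qPochInf (a * b * d * r) q * qPochInf (a * c * d * r) q *
        ∑' m, baileyAlpha q A (a * d) (a * r) (b * c) m *
          (qPoch (a * b) q m * qPoch (a * c) q m * (d * r) ^ m /
            (qPoch (a * b * d * r) q m * qPoch (a * c * d * r) q m)) =
      qPochInf (a * d * (a * r) * (b * c)) q * qPochInf (d * r) q *
        ∑' j, qPoch (a * b) q j * qPoch (a * c) q j * qPoch (b * c) q j * (d * r) ^ j /
          (qPoch q q j * qPoch (a * r * (b * c)) q j * qPoch (a * d * (b * c)) q j) := by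
  have hdr := norm_mul_lt_one hd hr
  have hbc := norm_mul_lt_one hb hc
  have har := norm_mul_lt_one ha hr
  have had := norm_mul_lt_one ha hd
  have hyu := norm_mul_lt_one har hbc
  have hxu := norm_mul_lt_one had hbc
  have hP := norm_mul_lt_one (norm_mul_lt_one had har) hbc
  have habdr := norm_mul_lt_one (norm_mul_lt_one (norm_mul_lt_one ha hb) hd) hr
  have hacdr := norm_mul_lt_one (norm_mul_lt_one (norm_mul_lt_one ha hc) hd) hr
  set T : ℕ × ℕ → ℂ := fun p => baileyAlpha q A (a * d) (a * r) (b * c) p.1 *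
    (qPoch (a * b) q (p.1 + p.2) * qPoch (a * c) q (p.1 + p.2) * (d * r) ^ (p.1 + p.2) /
      (qPoch q q p.2 * qPoch (a * d * (a * r) * (b * c)) q (p.1 + p.2 + p.1))) with hT
  have hsum : Summable fun p => ‖T p‖ := by
    have hu : ‖-(b * c) * (d * r)‖ < 1 := norm_mul_lt_one (by rwa [norm_neg]) hdr
    have hbdd : ∃ K : ℝ, ∀ p : ℕ × ℕ, ‖(1 - A)⁻¹ * (1 - A * q ^ (2 * p.1)) * qPoch A q p.1 *
        qPoch (a * d) q p.1 * qPoch (a * r) q p.1 * (qPoch q q p.1)⁻¹ *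
        (qPoch (a * r * (b * c)) q p.1)⁻¹ * (qPoch (a * d * (b * c)) q p.1)⁻¹ *
        q ^ (p.1 * (p.1 - 1) / 2) * qPoch (a * b) q (p.1 + p.2) * qPoch (a * c) q (p.1 + p.2) *
        (qPoch q q p.2)⁻¹ *
        (qPoch (a * d * (a * r) * (b * c)) q (p.1 + p.2 + p.1))⁻¹‖ ≤ K := by
      repeat' with_reducible apply exists_norm_mul_le
      all_goals first
        | exact exists_norm_const_le _
        | exact exists_norm_one_sub_mul_pow_comp_le hq _ _
        | exact exists_norm_qPoch_comp_le hq _ _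
        | exact exists_norm_pow_comp_le hq.le _
        | exact exists_norm_inv_qPoch_comp_le hq (by assumption) _
    refine (summable_norm_mul_of_bounded hbdd (summable_norm_pow_mul_pow hu hdr)).congr
      fun p => ?_
    simp only [hT, baileyAlpha, div_eq_mul_inv, mul_inv]
    congr 1
    ring
  have h := tsum_sum_antidiagonal hsum
  have hL : ∀ j, ∑ p ∈ Finset.HasAntidiagonal.antidiagonal j, T p =
      qPoch (a * b) q j * qPoch (a * c) q j * qPoch (b * c) q j * (d * r) ^ j /
        (qPoch q q j * qPoch (a * r * (b * c)) q j * qPoch (a * d * (b * c)) q j) := by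
    intro j
    have hs := sum_baileyAlpha (j := j) hq hq0 hA hA1 hyu hxu hP
    have : qPoch (a * b) q j * qPoch (a * c) q j * qPoch (b * c) q j * (d * r) ^ j /
        (qPoch q q j * qPoch (a * r * (b * c)) q j * qPoch (a * d * (b * c)) q j) =
      qPoch (a * b) q j * qPoch (a * c) q j * (d * r) ^ j * (qPoch (b * c) q j /
        (qPoch q q j * qPoch (a * r * (b * c)) q j * qPoch (a * d * (b * c)) q j)) := by ring
    rw [this, ← hs, Finset.mul_sum, Finset.Nat.sum_antidiagonal_eq_sum_range_succ_mk]
    refine Finset.sum_congr rfl fun m hm => ?_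
    have hmj : m + (j - m) = j := by have := Finset.mem_range.mp hm; omega
    simp only [hT, hmj]
    ring
  rw [tsum_congr hL] at h
  rw [h, ← tsum_mul_left, ← tsum_mul_left]
  refine tsum_congr fun m => ?_
  simp only [hT]
  rw [tsum_mul_left]
  linear_combination (-baileyAlpha q A (a * d) (a * r) (b * c) m) *
    tsum_qGauss_shift hq hdr hP habdr hacdr m

/-! ### The double series of the theorem -/

/-- Reversal of `(q^{-n}; q)_k` for `n = k + m`. -/
theorem qPoch_neg_pow {q : ℂ} (hq0 : q ≠ 0) (k m : ℕ) :
    q ^ ((k + m) * (k + m - 1) / 2) * qPoch (q ^ (-((k + m : ℕ) : ℤ))) q k * q ^ k *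
        qPoch q q m =
      (-1) ^ k * qPoch q q (k + m) * q ^ (m * (m - 1) / 2) := by
  induction k with
  | zero => simp [qPoch_zero]; ring
  | succ k ih =>
    have e1 : k + 1 + m = k + m + 1 := by omega
    have e2 : q ^ (-((k + m + 1 : ℕ) : ℤ)) * q = q ^ (-((k + m : ℕ) : ℤ)) := by
      rw [← zpow_add_one₀ hq0]; congr 1; push_cast; ring
    have e3 : q * q ^ (k + m) * q ^ (-((k + m + 1 : ℕ) : ℤ)) = 1 := by
      rw [← pow_succ', ← zpow_natCast q (k + m + 1), ← zpow_add₀ hq0]; simp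
    rw [e1, pow_triangle_succ, add_comm k 1, qPoch_add _ q 1 k, pow_one, e2, qPoch_succ q q (k + m)]
    simp only [qPoch, Finset.prod_range_one, pow_zero, mul_one, pow_add, pow_one] at *
    linear_combination q ^ (k + m) * q * (1 - q ^ (-((k + m + 1 : ℕ) : ℤ))) * ih -
      (-1) ^ k * (∏ i ∈ Finset.range (k + m), (1 - q * q ^ i)) * q ^ (m * (m - 1) / 2) * e3

/-- A terminating `₄φ₃`, whose terms vanish beyond the index `n`. -/
theorem qHyp_neg_pow {q : ℂ} (hq0 : q ≠ 0) (n : ℕ) (x y v s t h w : ℂ) :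
    qHyp [q ^ (-(n : ℤ)), x, y, v] [s, t, h] q w =
      ∑ k ∈ Finset.range (n + 1), qHypTerm [q ^ (-(n : ℤ)), x, y, v] [s, t, h] q w k := by
  refine tsum_eq_sum fun k hk => ?_
  have h0 : qPoch (q ^ (-(n : ℤ))) q k = 0 := by
    refine Finset.prod_eq_zero (i := n) (by simpa using hk) ?_
    rw [← zpow_natCast q n, ← zpow_add₀ hq0]
    simp
  simp only [qHypTerm, qPochs, List.map_cons, List.prod_cons, h0, zero_mul, zero_div]

theorem summable_norm_qHypTerm_three_two {q x y u v w z : ℂ} (hq : ‖q‖ < 1) (hv : ‖v‖ < 1)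
    (hw : ‖w‖ < 1) (hz : ‖z‖ < 1) :
    Summable fun k => ‖qHypTerm [x, y, u] [v, w] q z k‖ := by
  have hbdd : ∃ K : ℝ, ∀ k : ℕ, ‖qPoch x q k * qPoch y q k * qPoch u q k * (qPoch q q k)⁻¹ *
      (qPoch v q k)⁻¹ * (qPoch w q k)⁻¹‖ ≤ K := by
    repeat' with_reducible apply exists_norm_mul_le
    all_goals first
      | exact exists_norm_qPoch_comp_le hq _ _
      | exact exists_norm_inv_qPoch_comp_le hq (by assumption) _
  have hg : Summable fun k : ℕ => ‖z ^ k‖ := by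
    simpa only [norm_pow] using summable_geometric_of_lt_one (norm_nonneg z) hz
  refine (summable_norm_mul_of_bounded hbdd hg).congr fun k => ?_
  simp only [qHypTerm, qPochs, List.map_cons, List.map_nil, List.prod_cons, List.prod_nil,
    div_eq_mul_inv, mul_inv, mul_one]
  congr 1
  ring

/-- The terms of the double series that arises from the right-hand side when the terminating
`₄φ₃` is expanded: `p = (k, m)` stands for the `k`-th term of the `₄φ₃` inside the outer term of
index `k + m`. -/
noncomputable def expandedTerm (q a b c d r s t h β δ z α : ℂ) (p : ℕ × ℕ) : ℂ :=
  qPoch β q p.1 * qPoch δ q p.1 * z ^ p.1 /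
      (qPoch q q p.1 * qPoch s q p.1 * qPoch t q p.1 * qPoch h q p.1) *
    ((1 - α * q ^ (2 * (p.1 + p.2))) * qPoch α q (p.1 + p.2 + p.1) *
      (qPoch (a * b) q (p.1 + p.2) * qPoch (a * c) q (p.1 + p.2) * qPoch (a * d) q (p.1 + p.2) *
        qPoch (a * r) q (p.1 + p.2)) /
      ((1 - α) * qPoch q q p.2 * (qPoch (a * b * c * d) q (p.1 + p.2) *
        qPoch (a * b * c * r) q (p.1 + p.2) * qPoch (a * b * d * r) q (p.1 + p.2) *
        qPoch (a * c * d * r) q (p.1 + p.2)))) *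
    (-1) ^ p.2 * (b * c * d * r) ^ (p.1 + p.2) * q ^ (p.2 * (p.2 - 1) / 2)

theorem summable_norm_expandedTerm {q a b c d r s t h z : ℂ} (β δ α : ℂ) (hq : ‖q‖ < 1)
    (ha : ‖a‖ < 1) (hb : ‖b‖ < 1) (hc : ‖c‖ < 1) (hd : ‖d‖ < 1) (hr : ‖r‖ < 1)
    (hs : ‖s‖ < 1) (ht : ‖t‖ < 1) (hh : ‖h‖ < 1) (hz : ‖z‖ ≤ 1) :
    Summable fun p => ‖expandedTerm q a b c d r s t h β δ z α p‖ := by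
  have hbcdr := norm_mul_lt_one (norm_mul_lt_one (norm_mul_lt_one hb hc) hd) hr
  have habcd := norm_mul_lt_one (norm_mul_lt_one (norm_mul_lt_one ha hb) hc) hd
  have habcr := norm_mul_lt_one (norm_mul_lt_one (norm_mul_lt_one ha hb) hc) hr
  have habdr := norm_mul_lt_one (norm_mul_lt_one (norm_mul_lt_one ha hb) hd) hr
  have hacdr := norm_mul_lt_one (norm_mul_lt_one (norm_mul_lt_one ha hc) hd) hr
  have hu : ‖b * c * d * r * z‖ < 1 := by
    rw [norm_mul]
    exact mul_lt_one_of_nonneg_of_lt_one_left (norm_nonneg _) hbcdr hz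
  have hw : ‖-(b * c * d * r)‖ < 1 := by rwa [norm_neg]
  have hbdd : ∃ K : ℝ, ∀ p : ℕ × ℕ, ‖qPoch β q p.1 * qPoch δ q p.1 * (qPoch q q p.1)⁻¹ *
      (qPoch s q p.1)⁻¹ * (qPoch t q p.1)⁻¹ * (qPoch h q p.1)⁻¹ *
      (1 - α * q ^ (2 * (p.1 + p.2))) * qPoch α q (p.1 + p.2 + p.1) *
      qPoch (a * b) q (p.1 + p.2) * qPoch (a * c) q (p.1 + p.2) * qPoch (a * d) q (p.1 + p.2) *
      qPoch (a * r) q (p.1 + p.2) * (1 - α)⁻¹ * (qPoch q q p.2)⁻¹ *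
      (qPoch (a * b * c * d) q (p.1 + p.2))⁻¹ * (qPoch (a * b * c * r) q (p.1 + p.2))⁻¹ *
      (qPoch (a * b * d * r) q (p.1 + p.2))⁻¹ * (qPoch (a * c * d * r) q (p.1 + p.2))⁻¹ *
      q ^ (p.2 * (p.2 - 1) / 2)‖ ≤ K := by
    repeat' with_reducible apply exists_norm_mul_le
    all_goals first
      | exact exists_norm_const_le _
      | exact exists_norm_one_sub_mul_pow_comp_le hq _ _
      | exact exists_norm_qPoch_comp_le hq _ _
      | exact exists_norm_pow_comp_le hq.le _
      | exact exists_norm_inv_qPoch_comp_le hq (by assumption) _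
  refine (summable_norm_mul_of_bounded hbdd (summable_norm_pow_mul_pow hu hw)).congr
    fun p => ?_
  simp only [expandedTerm, div_eq_mul_inv, mul_inv, mul_pow, neg_pow (b * c * d * r), pow_add]
  congr 1
  ring

theorem expandedTerm_eq_mul_qHypTerm {q : ℂ} (hq : ‖q‖ < 1) (hq0 : q ≠ 0)
    (a b c d r s t h β δ z α : ℂ) (k m : ℕ) :
    (1 - α * q ^ (2 * (k + m))) * qPochs [α, a * b, a * c, a * d, a * r] q (k + m) /
          ((1 - α) * qPochs [q, a * b * c * d, a * b * c * r, a * b * d * r, a * c * d * r] q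
            (k + m)) *
        (-(b * c * d * r)) ^ (k + m) * q ^ ((k + m) * (k + m - 1) / 2) *
        qHypTerm [q ^ (-((k + m : ℕ) : ℤ)), α * q ^ (k + m), β, δ] [s, t, h] q (q * z) k =
      expandedTerm q a b c d r s t h β δ z α (k, m) := by
  have h1 := qPoch_ne_zero hq hq (k + m)
  have h2 := qPoch_ne_zero hq hq m
  have hL : q ^ ((k + m) * (k + m - 1) / 2) * qPoch (q ^ (-((k + m : ℕ) : ℤ))) q k * q ^ k *
      (qPoch q q (k + m))⁻¹ = (-1) ^ k * q ^ (m * (m - 1) / 2) * (qPoch q q m)⁻¹ := by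
    have := qPoch_neg_pow hq0 k m
    field_simp
    linear_combination this
  have hsq : ((-1 : ℂ) ^ k) * (-1) ^ k = 1 := by rw [← mul_pow]; simp
  simp only [expandedTerm, qHypTerm, qPochs, List.map_cons, List.map_nil, List.prod_cons,
    List.prod_nil, mul_one, div_eq_mul_inv, mul_inv]
  rw [qPoch_add α q (k + m) k, neg_pow (b * c * d * r), pow_add (-1 : ℂ), mul_pow q z]
  generalize q ^ ((k + m) * (k + m - 1) / 2) = G at *
  generalize qPoch (q ^ (-((k + m : ℕ) : ℤ))) q k = x at *
  generalize q ^ (m * (m - 1) / 2) = G' at *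
  generalize (qPoch q q (k + m))⁻¹ = f at *
  generalize (qPoch q q m)⁻¹ = f' at *
  generalize q ^ k = Q at *
  generalize (-1 : ℂ) ^ k = e at *
  generalize (-1 : ℂ) ^ m = e' at *
  generalize (b * c * d * r) ^ (k + m) = W at *
  generalize (1 - α * q ^ (2 * (k + m))) = X at *
  generalize (1 - α)⁻¹ = Y at *
  generalize (qPoch (a * b * c * d) q (k + m))⁻¹ = g₁
  generalize (qPoch (a * b * c * r) q (k + m))⁻¹ = g₂
  generalize (qPoch (a * b * d * r) q (k + m))⁻¹ = g₃
  generalize (qPoch (a * c * d * r) q (k + m))⁻¹ = g₄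
  generalize qPoch (a * b) q (k + m) = f₁
  generalize qPoch (a * c) q (k + m) = f₂
  generalize qPoch (a * d) q (k + m) = f₃
  generalize qPoch (a * r) q (k + m) = f₄
  linear_combination
    X * (qPoch α q (k + m) * qPoch (α * q ^ (k + m)) q k) * (f₁ * f₂ * f₃ * f₄) * Y *
      (g₁ * g₂ * g₃ * g₄) * e' * W * (qPoch β q k * qPoch δ q k * z ^ k) *
      ((qPoch q q k)⁻¹ * (qPoch s q k)⁻¹ * (qPoch t q k)⁻¹ * (qPoch h q k)⁻¹) *
      (e * hL + G' * f' * hsq)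

/-- The rows of the double series are the series of `watson_limit` with `a` replaced by
`a q ^ k`. -/
theorem expandedTerm_eq_mul_baileyAlpha {q α : ℂ} (hα1 : α ≠ 1)
    (a b c d r s t h β δ z : ℂ) (k m : ℕ) (hαk : α * q ^ (2 * k) ≠ 1) :
    expandedTerm q a b c d r s t h β δ z α (k, m) =
      qPoch β q k * qPoch δ q k * z ^ k /
          (qPoch q q k * qPoch s q k * qPoch t q k * qPoch h q k) *
        (qPoch (a * b) q k * qPoch (a * c) q k * qPoch (a * d) q k * qPoch (a * r) q k *
          (b * c * d * r) ^ k * qPoch (α * q) q (2 * k) /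
          (qPoch (a * b * c * d) q k * qPoch (a * b * c * r) q k * qPoch (a * b * d * r) q k *
            qPoch (a * c * d * r) q k)) *
        (baileyAlpha q (α * q ^ (2 * k)) (a * q ^ k * d) (a * q ^ k * r) (b * c) m *
          (qPoch (a * q ^ k * b) q m * qPoch (a * q ^ k * c) q m * (d * r) ^ m /
            (qPoch (a * q ^ k * b * d * r) q m * qPoch (a * q ^ k * c * d * r) q m))) := by
  have hα1' : 1 - α ≠ 0 := sub_ne_zero.mpr (Ne.symm hα1)
  have hαk' : 1 - α * q ^ (2 * k) ≠ 0 := sub_ne_zero.mpr (Ne.symm hαk)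
  have hshift : (1 - α * q ^ (2 * (k + m))) * qPoch α q (k + m + k) / (1 - α) =
      qPoch (α * q) q (2 * k) * ((1 - α * q ^ (2 * k) * q ^ (2 * m)) *
        qPoch (α * q ^ (2 * k)) q m / (1 - α * q ^ (2 * k))) := by
    rw [show k + m + k = 2 * k + m by omega, qPoch_add α q (2 * k) m]
    have := one_sub_mul_qPoch α q (2 * k)
    rw [show α * q ^ (2 * k) * q ^ (2 * m) = α * q ^ (2 * (k + m)) by ring]
    field_simp
    linear_combination
      (-(1 - α * q ^ (2 * (k + m))) * qPoch (α * q ^ (2 * k)) q m) * this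
  have e1 : a * q ^ k * d = a * d * q ^ k := by ring
  have e2 : a * q ^ k * r = a * r * q ^ k := by ring
  have e3 : a * q ^ k * b = a * b * q ^ k := by ring
  have e4 : a * q ^ k * c = a * c * q ^ k := by ring
  have e5 : a * b * q ^ k * d * r = a * b * d * r * q ^ k := by ring
  have e6 : a * c * q ^ k * d * r = a * c * d * r * q ^ k := by ring
  have e7 : a * r * q ^ k * (b * c) = a * b * c * r * q ^ k := by ring
  have e8 : a * d * q ^ k * (b * c) = a * b * c * d * q ^ k := by ring
  have e9 : (-1 : ℂ) ^ m * (b * c * d * r) ^ (k + m) =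
      (b * c * d * r) ^ k * ((-(b * c)) ^ m * (d * r) ^ m) := by
    rw [← mul_pow, show -(b * c) * (d * r) = -1 * (b * c * d * r) by ring, mul_pow, pow_add]
    ring
  have e : ∀ x₁ x₂ x₃ x₄ x₅ x₆ x₇ : ℂ, x₁ * (x₂ * x₃ * x₄ / ((1 - α) * x₅ * x₆)) *
      (-1) ^ m * (b * c * d * r) ^ (k + m) * x₇ = x₁ * (x₂ * x₃ / (1 - α)) * x₄ / (x₅ * x₆) *
      ((-1) ^ m * (b * c * d * r) ^ (k + m)) * x₇ := by
    intros
    field_simp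
  rw [expandedTerm, e]
  dsimp only
  rw [hshift, e9]
  simp only [baileyAlpha, e1, e2, e3, e4, e5, e6, e7, e8, qPoch_add _ q k m, div_eq_mul_inv,
    mul_inv]
  ring

theorem tsum_expandedTerm {q a b c d r α : ℂ} (hq : ‖q‖ < 1) (hq0 : q ≠ 0)
    (ha : ‖a‖ < 1) (hb : ‖b‖ < 1) (hc : ‖c‖ < 1) (hd : ‖d‖ < 1) (hr : ‖r‖ < 1)
    (hα : α = a ^ 2 * b * c * d * r / q) (hα1 : α ≠ 1) (s t h β δ z : ℂ) (k : ℕ) :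
    qPochInf (a * b * d * r) q * qPochInf (a * c * d * r) q *
        ∑' m, expandedTerm q a b c d r s t h β δ z α (k, m) =
      qPochInf (d * r) q * qPochInf (q * α) q *
        (qPochs [β, δ, a * b, a * c, a * d, a * r] q k * (b * c * d * r * z) ^ k /
            qPochs [q, s, t, h, a * b * c * d, a * b * c * r] q k *
          qHyp [a * b * q ^ k, a * c * q ^ k, b * c]
            [a * b * c * d * q ^ k, a * b * c * r * q ^ k] q (d * r)) := by
  have habdr := norm_mul_lt_one (norm_mul_lt_one (norm_mul_lt_one ha hb) hd) hr
  have hacdr := norm_mul_lt_one (norm_mul_lt_one (norm_mul_lt_one ha hc) hd) hr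
  have hqα : q * α = a * d * (a * r) * (b * c) := by rw [hα]; field_simp
  have hP : ‖q * α‖ < 1 := by
    rw [hqα]
    exact norm_mul_lt_one (norm_mul_lt_one (norm_mul_lt_one ha hd) (norm_mul_lt_one ha hr))
      (norm_mul_lt_one hb hc)
  have hαk : α * q ^ (2 * k) ≠ 1 := by
    rcases k with _ | k
    · simpa using hα1
    · rw [show α * q ^ (2 * (k + 1)) = q * α * q ^ (2 * k + 1) by ring]
      exact fun h => one_sub_mul_pow_ne_zero hq hP _ (by rw [h, sub_self])
  have hw := watson_limit (q := q) (a := a * q ^ k) (A := α * q ^ (2 * k)) hq hq0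
    ((norm_mul_pow_le hq a k).trans_lt ha) hb hc hd hr (by rw [hα]; field_simp; ring) hαk
  simp_rw [expandedTerm_eq_mul_baileyAlpha hα1 a b c d r s t h β δ z k _ hαk]
  rw [tsum_mul_left]
  generalize ∑' m, baileyAlpha q (α * q ^ (2 * k)) (a * q ^ k * d) (a * q ^ k * r) (b * c) m *
    (qPoch (a * q ^ k * b) q m * qPoch (a * q ^ k * c) q m * (d * r) ^ m /
      (qPoch (a * q ^ k * b * d * r) q m * qPoch (a * q ^ k * c * d * r) q m)) = S at *
  have hH : ∑' j, qPoch (a * q ^ k * b) q j * qPoch (a * q ^ k * c) q j * qPoch (b * c) q j *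
        (d * r) ^ j / (qPoch q q j * qPoch (a * q ^ k * r * (b * c)) q j *
          qPoch (a * q ^ k * d * (b * c)) q j) =
      qHyp [a * b * q ^ k, a * c * q ^ k, b * c]
        [a * b * c * d * q ^ k, a * b * c * r * q ^ k] q (d * r) := by
    refine tsum_congr fun j => ?_
    simp only [qHypTerm, qPochs, List.map_cons, List.map_nil, List.prod_cons, List.prod_nil,
      mul_one]
    rw [show a * q ^ k * b = a * b * q ^ k by ring, show a * q ^ k * c = a * c * q ^ k by ring,
      show a * q ^ k * r * (b * c) = a * b * c * r * q ^ k by ring,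
      show a * q ^ k * d * (b * c) = a * b * c * d * q ^ k by ring]
    congr 1 <;> ring
  rw [hH] at hw
  have h1 := qPoch_ne_zero hq habdr k
  have h2 := qPoch_ne_zero hq hacdr k
  rw [qPochInf_eq_mul (a * b * d * r) hq k, qPochInf_eq_mul (a * c * d * r) hq k,
    qPochInf_eq_mul (q * α) hq (2 * k)]
  rw [show a * q ^ k * b * d * r = a * b * d * r * q ^ k by ring,
    show a * q ^ k * c * d * r = a * c * d * r * q ^ k by ring,
    show a * q ^ k * d * (a * q ^ k * r) * (b * c) = a * d * (a * r) * (b * c) * q ^ (2 * k) by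
      ring, ← hqα] at hw
  simp only [qPochs, List.map_cons, List.map_nil, List.prod_cons, List.prod_nil, mul_one,
    mul_comm α q, mul_pow (b * c * d * r) z, div_eq_mul_inv, mul_inv]
  generalize qHyp _ _ q (d * r) = H at *
  have i1 := mul_inv_cancel₀ h1
  have i2 := mul_inv_cancel₀ h2
  generalize qPoch (a * b * d * r) q k = f₁ at *
  generalize qPoch (a * c * d * r) q k = f₂ at *
  generalize hX : qPoch β q k * qPoch δ q k * z ^ k *
      ((qPoch q q k)⁻¹ * (qPoch s q k)⁻¹ * (qPoch t q k)⁻¹ * (qPoch h q k)⁻¹) *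
      (qPoch (a * b) q k * qPoch (a * c) q k * qPoch (a * d) q k * qPoch (a * r) q k) *
      (b * c * d * r) ^ k * qPoch (q * α) q (2 * k) *
      ((qPoch (a * b * c * d) q k)⁻¹ * (qPoch (a * b * c * r) q k)⁻¹) = X
  calc _ = X * (f₁ * f₁⁻¹) * (f₂ * f₂⁻¹) *
        (qPochInf (a * b * d * r * q ^ k) q * qPochInf (a * c * d * r * q ^ k) q * S) := by
        rw [← hX]; ring
    _ = X * (qPochInf (q * α * q ^ (2 * k)) q * qPochInf (d * r) q * H) := by
        rw [i1, i2, hw]; ring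
    _ = _ := by rw [← hX]; ring

theorem theorem1p7
    (q : ℝ) (hq0 : 0 < q) (hq1 : q < 1)
    (a b c d r s t h β δ z α : ℂ)
    (ha : ‖a‖ < 1) (hb : ‖b‖ < 1) (hc : ‖c‖ < 1) (hd : ‖d‖ < 1) (hr : ‖r‖ < 1)
    (hs : ‖s‖ < 1) (ht : ‖t‖ < 1) (hh : ‖h‖ < 1)
    (hα : α = a ^ 2 * b * c * d * r / q) (hα1 : α ≠ 1)
    -- `L n` is the `n`-th term of the outer series on the left
    (L : ℕ → ℂ)
    (hL : ∀ n, L n =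
      qPochs [β, δ, a * b, a * c, a * d, a * r] q n * (b * c * d * r * z) ^ n /
          qPochs [(q : ℂ), s, t, h, a * b * c * d, a * b * c * r] q n *
        qHyp [a * b * (q : ℂ) ^ n, a * c * (q : ℂ) ^ n, b * c]
          [a * b * c * d * (q : ℂ) ^ n, a * b * c * r * (q : ℂ) ^ n] q (d * r))
    -- `R n` is the `n`-th term of the series on the right
    (R : ℕ → ℂ)
    (hR : ∀ n, R n =
      (1 - α * (q : ℂ) ^ (2 * n)) * qPochs [α, a * b, a * c, a * d, a * r] q n /
          ((1 - α) *
            qPochs [(q : ℂ), a * b * c * d, a * b * c * r, a * b * d * r, a * c * d * r] q n) *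
        (-(b * c * d * r)) ^ n * (q : ℂ) ^ (n * (n - 1) / 2) *
        qHyp [(q : ℂ) ^ (-(n : ℤ)), α * (q : ℂ) ^ n, β, δ] [s, t, h] q (q * z))
    (hz : ‖z‖ < 1 ∨ (‖z‖ = 1 ∧ Summable fun n => ‖R n‖)) :
    (∀ n : ℕ, Summable fun k : ℕ =>
      ‖qHypTerm [a * b * (q : ℂ) ^ n, a * c * (q : ℂ) ^ n, b * c]
        [a * b * c * d * (q : ℂ) ^ n, a * b * c * r * (q : ℂ) ^ n] q (d * r) k‖) ∧
    (Summable fun n => ‖L n‖) ∧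
    (Summable fun n => ‖R n‖) ∧
    ∑' n, L n =
      qPochsInf [a * b * d * r, a * c * d * r] q / qPochsInf [d * r, q * α] q * ∑' n, R n := by
  have hqn : ‖(q : ℂ)‖ < 1 := by
    rw [Complex.norm_real, Real.norm_eq_abs, abs_of_pos hq0]; exact hq1
  have hqc : (q : ℂ) ≠ 0 := by exact_mod_cast hq0.ne'
  have hz1 : ‖z‖ ≤ 1 := hz.elim le_of_lt fun h => h.1.le
  have hdr := norm_mul_lt_one hd hr
  have habcd := norm_mul_lt_one (norm_mul_lt_one (norm_mul_lt_one ha hb) hc) hd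
  have habcr := norm_mul_lt_one (norm_mul_lt_one (norm_mul_lt_one ha hb) hc) hr
  have hqα : ‖(q : ℂ) * α‖ < 1 := by
    rw [show (q : ℂ) * α = a * d * (a * r) * (b * c) by rw [hα]; field_simp]
    exact norm_mul_lt_one (norm_mul_lt_one (norm_mul_lt_one ha hd) (norm_mul_lt_one ha hr))
      (norm_mul_lt_one hb hc)
  have hsum := summable_norm_expandedTerm β δ α hqn ha hb hc hd hr hs ht hh hz1
  set T := expandedTerm q a b c d r s t h β δ z α with hT
  -- the rows of the double series give the left-hand side
  have hLT : ∀ k, L k = qPochsInf [a * b * d * r, a * c * d * r] q /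
      qPochsInf [d * r, q * α] q * ∑' m, T (k, m) := by
    intro k
    have h1 := qPochInf_ne_zero hqn hdr
    have h2 := qPochInf_ne_zero hqn hqα
    simp only [qPochsInf, List.map_cons, List.map_nil, List.prod_cons, List.prod_nil, mul_one]
    rw [div_mul_eq_mul_div, eq_div_iff (mul_ne_zero h1 h2), hL, mul_comm,
      tsum_expandedTerm hqn hqc ha hb hc hd hr hα hα1 s t h β δ z k]
  -- its antidiagonals give the right-hand side
  have hRT : ∀ n, R n = ∑ p ∈ Finset.HasAntidiagonal.antidiagonal n, T p := by
    intro n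
    rw [hR, qHyp_neg_pow hqc, Finset.mul_sum,
      Finset.Nat.sum_antidiagonal_eq_sum_range_succ_mk]
    refine Finset.sum_congr rfl fun k hk => ?_
    obtain ⟨m, rfl⟩ := Nat.exists_eq_add_of_le (Nat.lt_succ_iff.mp (Finset.mem_range.mp hk))
    rw [Nat.add_sub_cancel_left, hT, ← expandedTerm_eq_mul_qHypTerm hqn hqc]
  refine ⟨fun n => ?_, ?_, ?_, ?_⟩
  · exact summable_norm_qHypTerm_three_two hqn ((norm_mul_pow_le hqn _ n).trans_lt habcd)
      ((norm_mul_pow_le hqn _ n).trans_lt habcr) hdr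
  · simp_rw [hLT, norm_mul]
    exact (summable_norm_tsum_prod hsum).mul_left _
  · simp_rw [hRT]
    exact summable_norm_sum_antidiagonal hsum
  · simp_rw [hLT, hRT]
    rw [tsum_mul_left, tsum_sum_antidiagonal hsum]
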